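/- **Language and algebras.** Let $\mathbf{Fm}$ be the algebra of formulas in the language $\{\wedge,\vee,\otimes,\oplus,\neg\}$ (four binary connectives, one unary, no constants) over a countably infinite set of variables. A *bilattice* is an algebra $\langle B,\wedge,\vee,\otimes,\oplus,\neg\rangle$ such that $\langle B,\wedge,\vee\rangle$ and $\langle B,\otimes,\oplus\rangle$ are lattices, with orders $\le_t$ and $\le_k$ respectively, and for all $a,b$: $a\le_t b$ implies $\neg b\le_t\neg a$; $a\le_k b$ implies $\neg a\le_k\neg b$; and $\neg\neg a=a$. It is *distributive* if $x\circ(y\bullet z)=(x\circ y)\bullet(x\circ z)$ for all distinct $\circ,\bullet\in\{\wedge,\vee,\otimes,\oplus\}$. Let $\mathsf{DBiLat}$ be the class of distributive bilattices. For a set $E\cup\{e\}$ of equations, $E\models_{\mathsf{DBiLat}} e$ means that for every $\mathbf B\in\mathsf{DBiLat}$, every homomorphism $h:\mathbf{Fm}\to\mathbf B$ that satisfies all equations of $E$ satisfies $e$. **The calculus.** A sequent $\Gamma\rhd\Delta$ is a pair of finite non-empty sets of formulas. The Gentzen calculus $\mathcal G_{LB}$ has the axioms $\Gamma,\varphi\rhd\varphi,\Delta$,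 the Cut rule (from $\Gamma\rhd\Delta,\varphi$ and $\Gamma',\varphi\rhd\Delta'$ infer $\Gamma,\Gamma'\rhd\Delta,\Delta'$), and the following logical rules, where contexts are finite, possibly empty, sets. * For $\circ\in\{\wedge,\otimes\}$: from $\Gamma,\varphi,\psi\rhd\Delta$ infer $\Gamma,\varphi\circ\psi\rhd\Delta$; from $\Gamma\rhd\Delta,\varphi$ and $\Gamma\rhd\Delta,\psi$ infer $\Gamma\rhd\Delta,\varphi\circ\psi$. * For $\circ\in\{\vee,\oplus\}$: from $\Gamma,\varphi\rhd\Delta$ and $\Gamma,\psi\rhd\Delta$ infer $\Gamma,\varphi\circ\psi\rhd\Delta$; from $\Gamma\rhd\Delta,\varphi,\psi$ infer $\Gamma\rhd\Delta,\varphi\circ\psi$. * For $\circ\in\{\wedge,\oplus\}$: from $\Gamma,\neg\varphi\rhd\Delta$ and $\Gamma,\neg\psi\rhd\Delta$ infer $\Gamma,\neg(\varphi\circ\psi)\rhd\Delta$; from $\Gamma\rhd\Delta,\neg\varphi,\neg\psi$ infer $\Gamma\rhd\Delta,\neg(\varphi\circ\psi)$. * For $\circ\in\{\vee,\otimes\}$: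 from $\Gamma,\neg\varphi,\neg\psi\rhd\Delta$ infer $\Gamma,\neg(\varphi\circ\psi)\rhd\Delta$; from $\Gamma\rhd\Delta,\neg\varphi$ and $\Gamma\rhd\Delta,\neg\psi$ infer $\Gamma\rhd\Delta,\neg(\varphi\circ\psi)$. * From $\Gamma,\varphi\rhd\Delta$ infer $\Gamma,\neg\neg\varphi\rhd\Delta$; from $\Gamma\rhd\Delta,\varphi$ infer $\Gamma\rhd\Delta,\neg\neg\varphi$. For a set $X\cup\{s\}$ of sequents, write $X\mathrel{|\!\sim} s$ if $s$ is derivable in $\mathcal G_{LB}$ from the members of $X$ used as additional axioms. **Theorem.** $\mathsf{DBiLat}$ is a variety (it is the class of models of a set of equations), and $\mathcal G_{LB}$ is algebraizable, in the sense of Rebagliato and Verdú, with respect to $\mathsf{DBiLat}$, with the translations $$\tau(\Gamma\rhd\Delta)=\{\textstyle\bigwedge\Gamma\wedge(\bigwedge\Gamma\otimes\bigvee\Delta)\approx\bigwedge\Gamma\},\qquad \rho(\varphi\approx\psi)=\{\varphi\rhd\psi,\ \neg\varphi\rhd\neg\psi,\ \psi\rhd\varphi,\ \neg\psi\rhd\neg\varphi\}.$$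 Here $\bigwedge\Gamma$ is the formula $(\cdots(\varphi_0\wedge\varphi_1)\wedge\cdots)\wedge\varphi_m$ for a listing $\varphi_0,\dots,\varphi_m$ of $\Gamma$, in any order and possibly with repetitions, and $\bigvee\Delta$ is formed likewise; the statement holds whatever listings are used for the sequents involved. Explicitly, $|\!\sim$ is a finitary, substitution-invariant consequence relation on sequents, and 1. for every set $X\cup\{s\}$ of sequents, $X\mathrel{|\!\sim}s$ if and only if $\bigcup_{x\in X}\tau(x)\models_{\mathsf{DBiLat}}e$ for every $e\in\tau(s)$; 2. for every equation $\varphi\approx\psi$, writing $\tau\rho(\varphi\approx\psi)=\bigcup_{x\in\rho(\varphi\approx\psi)}\tau(x)$, we have $\{\varphi\approx\psi\}\models_{\mathsf{DBiLat}}e$ for every $e\in\tau\rho(\varphi\approx\psi)$, and $\tau\rho(\varphi\approx\psi)\models_{\mathsf{DBiLat}}\varphi\approx\psi$. -/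

import Mathlib

universe u v w

/-! ### Algebras and formulas of the language `{∧, ∨, ⊗, ⊕, ¬}` -/

/-- Algebras of the type `⟨∧, ∨, ⊗, ⊕, ¬⟩` (four binary operations, one unary), with no laws. -/
class BilatAlg (A : Type u) where
  and : A → A → A
  or : A → A → A
  tensor : A → A → A
  oplus : A → A → A
  neg : A → A

/-- Formulas over a set `V` of variables. -/
inductive Fm (V : Type v) : Type v
  | var : V → Fm V
  | and : Fm V → Fm V → Fm V
  | or : Fm V → Fm V → Fm V
  | tensor : Fm V → Fm V → Fm V
  | oplus : Fm V → Fm V → Fm V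
  | neg : Fm V → Fm V
  deriving DecidableEq

/-- The formula algebra. -/
instance Fm.instBilatAlg (V : Type v) : BilatAlg (Fm V) where
  and := Fm.and
  or := Fm.or
  tensor := Fm.tensor
  oplus := Fm.oplus
  neg := Fm.neg

/-- The homomorphism from the formula algebra to `A` that extends `h : V → A`. -/
def Fm.eval {V : Type v} {A : Type u} [BilatAlg A] (h : V → A) : Fm V → A
  | .var x => h x
  | .and φ ψ => BilatAlg.and (φ.eval h) (ψ.eval h)
  | .or φ ψ => BilatAlg.or (φ.eval h) (ψ.eval h)
  | .tensor φ ψ => BilatAlg.tensor (φ.eval h) (ψ.eval h)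
  | .oplus φ ψ => BilatAlg.oplus (φ.eval h) (ψ.eval h)
  | .neg φ => BilatAlg.neg (φ.eval h)

/-- Substitution: a homomorphism between formula algebras. -/
def Fm.subst {V : Type v} {W : Type w} (σ : V → Fm W) (φ : Fm V) : Fm W :=
  φ.eval σ

/-- `(⋯ ((f 0 ∧ f 1) ∧ f 2) ⋯ ) ∧ f n`. -/
def bigAnd {V : Type v} : (n : ℕ) → (Fin (n + 1) → Fm V) → Fm V
  | 0, f => f 0
  | n + 1, f => Fm.and (bigAnd n fun i => f i.castSucc) (f (Fin.last (n + 1)))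

/-- `(⋯ ((f 0 ∨ f 1) ∨ f 2) ⋯ ) ∨ f n`. -/
def bigOr {V : Type v} : (n : ℕ) → (Fin (n + 1) → Fm V) → Fm V
  | 0, f => f 0
  | n + 1, f => Fm.or (bigOr n fun i => f i.castSucc) (f (Fin.last (n + 1)))

/-! ### Equations and equational consequence -/

/-- An equation `lhs ≈ rhs`. -/
structure Equation (V : Type v) : Type v where
  lhs : Fm V
  rhs : Fm V

def Equation.subst {V : Type v} {W : Type w} (σ : V → Fm W) (e : Equation V) : Equation W :=
  ⟨e.lhs.subst σ, e.rhs.subst σ⟩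

/-- The equation `e` is true in `A` under the valuation `h`. -/
def Equation.Holds {V : Type v} {A : Type u} [BilatAlg A] (h : V → A) (e : Equation V) : Prop :=
  e.lhs.eval h = e.rhs.eval h

/-- `E ⊨_K e`, for a class `K` of algebras. -/
def EqConseq (K : ∀ (A : Type u) [BilatAlg A], Prop)
    (E : Set (Equation ℕ)) (e : Equation ℕ) : Prop :=
  ∀ (A : Type u) [BilatAlg A], K A →
    ∀ h : ℕ → A, (∀ d ∈ E, d.Holds h) → e.Holds h

/-- `K` is a variety: it is the class of all models of some set of equations. -/
def IsVariety (K : ∀ (A : Type u) [BilatAlg A], Prop) : Prop :=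
  ∃ E : Set (Equation ℕ), ∀ (A : Type u) [BilatAlg A],
    K A ↔ ∀ e ∈ E, ∀ h : ℕ → A, e.Holds h

/-! ### Distributive bilattices -/

/-- The lattice identities for a meet `m` and a join `j`. -/
structure IsLatticePair {A : Type u} (m j : A → A → A) : Prop where
  meet_comm : ∀ x y, m x y = m y x
  join_comm : ∀ x y, j x y = j y x
  meet_assoc : ∀ x y z, m (m x y) z = m x (m y z)
  join_assoc : ∀ x y z, j (j x y) z = j x (j y z)
  meet_join : ∀ x y, m x (j x y) = x
  join_meet : ∀ x y, j x (m x y) = x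

/-- Names for the four lattice operations. -/
inductive LatOp
  | and | or | tensor | oplus

def LatOp.app {A : Type u} [BilatAlg A] : LatOp → A → A → A
  | .and => BilatAlg.and
  | .or => BilatAlg.or
  | .tensor => BilatAlg.tensor
  | .oplus => BilatAlg.oplus

/-- Bilattices (with negation); `x ≤ₜ y` is `x ∧ y = x` and `x ≤ₖ y` is `x ⊗ y = x`. -/
structure IsBilattice (A : Type u) [BilatAlg A] : Prop where
  truth : IsLatticePair (A := A) BilatAlg.and BilatAlg.or
  knowledge : IsLatticePair (A := A) BilatAlg.tensor BilatAlg.oplus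
  neg_truth : ∀ x y : A, BilatAlg.and x y = x →
    BilatAlg.and (BilatAlg.neg y) (BilatAlg.neg x) = BilatAlg.neg y
  neg_knowledge : ∀ x y : A, BilatAlg.tensor x y = x →
    BilatAlg.tensor (BilatAlg.neg x) (BilatAlg.neg y) = BilatAlg.neg x
  neg_neg : ∀ x : A, BilatAlg.neg (BilatAlg.neg x) = x

/-- The class `DBiLat` of distributive bilattices: all twelve distributive laws hold. -/
structure DBiLat (A : Type u) [BilatAlg A] : Prop where
  bilattice : IsBilattice A
  distrib : ∀ o p : LatOp, o ≠ p →
    ∀ x y z : A, o.app x (p.app y z) = p.app (o.app x y) (o.app x z)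

/-! ### Gentzen systems and their algebraizability

Sequents are pairs of finite sequences of formulas of length at least one. A Gentzen system is a
finitary and substitution-invariant consequence relation between sequents. -/

/-- The sequent `ante 0, …, ante m ▷ succ 0, …, succ n`. -/
structure Sequent (V : Type v) : Type v where
  m : ℕ
  n : ℕ
  ante : Fin (m + 1) → Fm V
  succ : Fin (n + 1) → Fm V

def Sequent.subst {V : Type v} {W : Type w} (σ : V → Fm W) (s : Sequent V) : Sequent W :=
  ⟨s.m, s.n, fun i => (s.ante i).subst σ, fun j => (s.succ j).subst σ⟩

/-- `φ ▷ ψ`. -/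
def Sequent.single {V : Type v} (φ ψ : Fm V) : Sequent V :=
  ⟨0, 0, fun _ => φ, fun _ => ψ⟩

structure IsGentzenSystem (C : Set (Sequent ℕ) → Sequent ℕ → Prop) : Prop where
  refl : ∀ (X : Set (Sequent ℕ)), ∀ s ∈ X, C X s
  trans : ∀ (X Y : Set (Sequent ℕ)) (s : Sequent ℕ), (∀ y ∈ Y, C X y) → C Y s → C X s
  finitary : ∀ (X : Set (Sequent ℕ)) (s : Sequent ℕ), C X s → ∃ Y ⊆ X, Y.Finite ∧ C Y s
  structural : ∀ (σ : ℕ → Fm ℕ) (X : Set (Sequent ℕ)) (s : Sequent ℕ),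
    C X s → C (Sequent.subst σ '' X) (s.subst σ)

/-- A translation of sequents into equations: for each shape, a set of equations in variables
`p₀, …, pₘ` (the antecedent) and `q₀, …, qₙ` (the succedent). -/
abbrev SeqTranslation : Type :=
  (m n : ℕ) → Set (Equation (Fin (m + 1) ⊕ Fin (n + 1)))

/-- A translation of equations into sequents: a set of sequents in two variables. -/
abbrev EqTranslation : Type := Set (Sequent (Fin 2))

/-- `τ(s)`: put the formulas of `s` for the variables. -/
def SeqTranslation.apply (τ : SeqTranslation) (s : Sequent ℕ) : Set (Equation ℕ) :=
  Equation.subst (Sum.elim s.ante s.succ) '' τ s.m s.n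

/-- `τ(X)` for a set `X` of sequents. -/
def SeqTranslation.applySet (τ : SeqTranslation) (X : Set (Sequent ℕ)) : Set (Equation ℕ) :=
  ⋃ s ∈ X, τ.apply s

/-- `ρ(φ ≈ ψ)`: put `φ` and `ψ` for the two variables. -/
def EqTranslation.apply (ρ : EqTranslation) (e : Equation ℕ) : Set (Sequent ℕ) :=
  Sequent.subst ![e.lhs, e.rhs] '' ρ

/-- The consequence relation `C` is a Gentzen system, algebraizable in the sense of Rebagliato and
Verdú with equivalent algebraic semantics `K`, by the finite translations `τ` and `ρ`. -/
structure IsAlgebraizable (C : Set (Sequent ℕ) → Sequent ℕ → Prop)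
    (K : ∀ (A : Type u) [BilatAlg A], Prop) (τ : SeqTranslation) (ρ : EqTranslation) : Prop where
  system : IsGentzenSystem C
  finite_τ : ∀ m n, (τ m n).Finite
  finite_ρ : Set.Finite ρ
  conseq_iff : ∀ (X : Set (Sequent ℕ)) (s : Sequent ℕ),
    C X s ↔ ∀ e ∈ τ.apply s, EqConseq K (τ.applySet X) e
  eq_conseq_τρ : ∀ e : Equation ℕ, ∀ d ∈ τ.applySet (ρ.apply e), EqConseq K {e} d
  τρ_conseq_eq : ∀ e : Equation ℕ, EqConseq K (τ.applySet (ρ.apply e)) e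

/-! ### The calculus `G_LB` -/

/-- Derivability in `G_LB` from the set `H` of sequents. The two sides of a sequent are finite
sets; `insert φ Γ` is `Γ, φ`. The contexts `Γ`, `Δ` may be empty, but the rules derive only
sequents with non-empty sides if the sides of the members of `H` are non-empty. -/
inductive GLBDerives (H : Set (Finset (Fm ℕ) × Finset (Fm ℕ))) :
    Finset (Fm ℕ) → Finset (Fm ℕ) → Prop
  | hyp {Γ Δ} : (Γ, Δ) ∈ H → GLBDerives H Γ Δ
  | ax {Γ Δ} {φ : Fm ℕ} : GLBDerives H (insert φ Γ) (insert φ Δ)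
  | cut {Γ Γ' Δ Δ'} {φ : Fm ℕ} : GLBDerives H Γ (insert φ Δ) → GLBDerives H (insert φ Γ') Δ' →
      GLBDerives H (Γ ∪ Γ') (Δ ∪ Δ')
  | and_left {Γ Δ} {φ ψ : Fm ℕ} : GLBDerives H (insert φ (insert ψ Γ)) Δ →
      GLBDerives H (insert (φ.and ψ) Γ) Δ
  | and_right {Γ Δ} {φ ψ : Fm ℕ} : GLBDerives H Γ (insert φ Δ) → GLBDerives H Γ (insert ψ Δ) →
      GLBDerives H Γ (insert (φ.and ψ) Δ)
  | neg_and_left {Γ Δ} {φ ψ : Fm ℕ} : GLBDerives H (insert φ.neg Γ) Δ →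
      GLBDerives H (insert ψ.neg Γ) Δ → GLBDerives H (insert (φ.and ψ).neg Γ) Δ
  | neg_and_right {Γ Δ} {φ ψ : Fm ℕ} : GLBDerives H Γ (insert φ.neg (insert ψ.neg Δ)) →
      GLBDerives H Γ (insert (φ.and ψ).neg Δ)
  | or_left {Γ Δ} {φ ψ : Fm ℕ} : GLBDerives H (insert φ Γ) Δ → GLBDerives H (insert ψ Γ) Δ →
      GLBDerives H (insert (φ.or ψ) Γ) Δ
  | or_right {Γ Δ} {φ ψ : Fm ℕ} : GLBDerives H Γ (insert φ (insert ψ Δ)) →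
      GLBDerives H Γ (insert (φ.or ψ) Δ)
  | neg_or_left {Γ Δ} {φ ψ : Fm ℕ} : GLBDerives H (insert φ.neg (insert ψ.neg Γ)) Δ →
      GLBDerives H (insert (φ.or ψ).neg Γ) Δ
  | neg_or_right {Γ Δ} {φ ψ : Fm ℕ} : GLBDerives H Γ (insert φ.neg Δ) →
      GLBDerives H Γ (insert ψ.neg Δ) → GLBDerives H Γ (insert (φ.or ψ).neg Δ)
  | tensor_left {Γ Δ} {φ ψ : Fm ℕ} : GLBDerives H (insert φ (insert ψ Γ)) Δ →
      GLBDerives H (insert (φ.tensor ψ) Γ) Δ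
  | tensor_right {Γ Δ} {φ ψ : Fm ℕ} : GLBDerives H Γ (insert φ Δ) →
      GLBDerives H Γ (insert ψ Δ) → GLBDerives H Γ (insert (φ.tensor ψ) Δ)
  | neg_tensor_left {Γ Δ} {φ ψ : Fm ℕ} : GLBDerives H (insert φ.neg (insert ψ.neg Γ)) Δ →
      GLBDerives H (insert (φ.tensor ψ).neg Γ) Δ
  | neg_tensor_right {Γ Δ} {φ ψ : Fm ℕ} : GLBDerives H Γ (insert φ.neg Δ) →
      GLBDerives H Γ (insert ψ.neg Δ) → GLBDerives H Γ (insert (φ.tensor ψ).neg Δ)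
  | oplus_left {Γ Δ} {φ ψ : Fm ℕ} : GLBDerives H (insert φ Γ) Δ →
      GLBDerives H (insert ψ Γ) Δ → GLBDerives H (insert (φ.oplus ψ) Γ) Δ
  | oplus_right {Γ Δ} {φ ψ : Fm ℕ} : GLBDerives H Γ (insert φ (insert ψ Δ)) →
      GLBDerives H Γ (insert (φ.oplus ψ) Δ)
  | neg_oplus_left {Γ Δ} {φ ψ : Fm ℕ} : GLBDerives H (insert φ.neg Γ) Δ →
      GLBDerives H (insert ψ.neg Γ) Δ → GLBDerives H (insert (φ.oplus ψ).neg Γ) Δ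
  | neg_oplus_right {Γ Δ} {φ ψ : Fm ℕ} : GLBDerives H Γ (insert φ.neg (insert ψ.neg Δ)) →
      GLBDerives H Γ (insert (φ.oplus ψ).neg Δ)
  | neg_neg_left {Γ Δ} {φ : Fm ℕ} : GLBDerives H (insert φ Γ) Δ →
      GLBDerives H (insert φ.neg.neg Γ) Δ
  | neg_neg_right {Γ Δ} {φ : Fm ℕ} : GLBDerives H Γ (insert φ Δ) →
      GLBDerives H Γ (insert φ.neg.neg Δ)

/-- The pair of finite non-empty sets of formulas that a sequent lists. -/
def Sequent.toSets (s : Sequent ℕ) : Finset (Fm ℕ) × Finset (Fm ℕ) :=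
  (Finset.univ.image s.ante, Finset.univ.image s.succ)

/-- The consequence relation of `G_LB`. A sequent of `G_LB` is a pair of finite non-empty sets; it
may be listed by sequences in any order and with repetitions. -/
def GLB (X : Set (Sequent ℕ)) (s : Sequent ℕ) : Prop :=
  GLBDerives (Sequent.toSets '' X) s.toSets.1 s.toSets.2

/-- `τ(Γ ▷ Δ) = {⋀Γ ∧ (⋀Γ ⊗ ⋁Δ) ≈ ⋀Γ}`. -/
def tauLB : SeqTranslation := fun m n =>
  let p : Fm (Fin (m + 1) ⊕ Fin (n + 1)) := bigAnd m fun i => Fm.var (Sum.inl i)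
  let q : Fm (Fin (m + 1) ⊕ Fin (n + 1)) := bigOr n fun j => Fm.var (Sum.inr j)
  {⟨Fm.and p (Fm.tensor p q), p⟩}

/-- `ρ(φ ≈ ψ) = {φ ▷ ψ, ¬φ ▷ ¬ψ, ψ ▷ φ, ¬ψ ▷ ¬φ}`. -/
def rhoLB : EqTranslation :=
  let φ : Fm (Fin 2) := Fm.var 0
  let ψ : Fm (Fin 2) := Fm.var 1
  {Sequent.single φ ψ, Sequent.single φ.neg ψ.neg,
    Sequent.single ψ φ, Sequent.single ψ.neg φ.neg}

-- A distributive bilattice embeds in a product bilattice, and `Below` is the order of its first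
-- coordinate, a distributive lattice in which `∧`, `⊗` both become meet and `∨`, `⊕` both become
-- join. Thus `τ(Γ ▷ Δ)` says that the meet of the first coordinates of `Γ` lies below the join of
-- those of `Δ` (`holds_tau_iff`). Negation exchanges the coordinates, so an element is determined
-- by its own class and that of its negation (`eq_of_below`); this is the condition on `τρ`.
--
-- Soundness is the validity of the rules in distributive lattices, once negations are pushed
-- inward. For completeness, the two sides of an underivable sequent are separated by a set `T` such
-- that no sequent from `T` to its complement is derivable (`Consistent.exists_compl`). The logical
-- rules make "`φ ∈ T`, `¬φ ∈ T`" a homomorphism into the four-element bilattice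
-- (`Consistent.eval_eq`); it satisfies the hypotheses and refutes the sequent.
--
-- For the variety, the only non-equational axioms, the monotonicity conditions on negation, follow
-- from De Morgan-type identities.

local infixl:70 " ⋏ " => BilatAlg.and
local infixl:65 " ⋎ " => BilatAlg.or
local infixl:70 " ⊠ " => BilatAlg.tensor
local infixl:65 " ⊞ " => BilatAlg.oplus
local prefix:max "∼" => BilatAlg.neg

/-! ### Lattice identities -/

namespace IsLatticePair

variable {A : Type u} {m j : A → A → A}

theorem dual (h : IsLatticePair m j) : IsLatticePair j m :=
  ⟨h.join_comm, h.meet_comm, h.join_assoc, h.meet_assoc, h.join_meet, h.meet_join⟩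

/-- Absorption, with the second factor written as `j x (m x x)`. -/
theorem meet_self (h : IsLatticePair m j) (x : A) : m x x = x := by
  conv_lhs => rw [← h.join_meet x x]
  rw [h.join_meet x x]
  conv_lhs => arg 2; rw [← h.join_meet x x]
  exact h.meet_join x _

theorem join_eq_iff (h : IsLatticePair m j) {x y : A} : j x y = y ↔ m x y = x := by
  constructor
  · intro e; rw [← e, h.meet_join]
  · intro e; rw [← e, h.join_comm, h.meet_comm, h.join_meet]

theorem antisymm (h : IsLatticePair m j) {x y : A} (hxy : m x y = x) (hyx : m y x = y) :
    x = y := by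
  rw [← hxy, h.meet_comm, hyx]

theorem trans (h : IsLatticePair m j) {x y z : A} (hxy : m x y = x) (hyz : m y z = y) :
    m x z = x := by
  rw [← hxy, h.meet_assoc, hyz]

theorem meet_le_left (h : IsLatticePair m j) (x y : A) : m (m x y) x = m x y := by
  rw [h.meet_comm x y, h.meet_assoc, h.meet_self]

theorem meet_le_right (h : IsLatticePair m j) (x y : A) : m (m x y) y = m x y := by
  rw [h.meet_assoc, h.meet_self]

theorem le_meet (h : IsLatticePair m j) {x y z : A} (hy : m x y = x) (hz : m x z = x) :
    m x (m y z) = x := by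
  rw [← h.meet_assoc, hy, hz]

theorem le_join_left (h : IsLatticePair m j) (x y : A) : m x (j x y) = x :=
  h.meet_join x y

theorem le_join_right (h : IsLatticePair m j) (x y : A) : m y (j x y) = y := by
  rw [h.join_comm]; exact h.meet_join y x

theorem join_le (h : IsLatticePair m j) {x y z : A} (hx : m x z = x) (hy : m y z = y) :
    m (j x y) z = j x y := by
  rw [← h.join_eq_iff] at hx hy ⊢
  rw [h.join_assoc, hy, hx]

/-- An operation that distributes over the meet is monotone in its second argument. -/
theorem monotone_right (_ : IsLatticePair m j) {o : A → A → A}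
    (ho : ∀ x y z, o x (m y z) = m (o x y) (o x z)) {x y z : A} (hyz : m y z = y) :
    m (o x y) (o x z) = o x y := by
  rw [← ho, hyz]

theorem monotone (h : IsLatticePair m j) {o : A → A → A} (hc : ∀ x y, o x y = o y x)
    (ho : ∀ x y z, o x (m y z) = m (o x y) (o x z)) {x x' y y' : A} (hx : m x x' = x)
    (hy : m y y' = y) : m (o x y) (o x' y') = o x y := by
  refine h.trans (h.monotone_right ho hy) ?_
  rw [hc x, hc x']
  exact h.monotone_right ho hx

theorem neg_meet (h : IsLatticePair m j) {n : A → A} (hn : ∀ x, n (n x) = x)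
    (ha : ∀ x y, m x y = x → m (n y) (n x) = n y) (x y : A) : n (m x y) = j (n x) (n y) := by
  refine h.antisymm ?_ (h.join_le (ha _ _ (h.meet_le_left _ _)) (ha _ _ (h.meet_le_right _ _)))
  -- `n (j (n x) (n y))` is below both `x` and `y`, hence below their meet; one more `n` gives the
  -- remaining inequality.
  have hx := ha _ _ (h.le_join_left (n x) (n y))
  have hy := ha _ _ (h.le_join_right (n x) (n y))
  rw [hn] at hx hy
  simpa only [hn] using ha _ _ (h.le_meet hx hy)

theorem map_meet_of_monotone (h : IsLatticePair m j) {n : A → A} (hn : ∀ x, n (n x) = x)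
    (ha : ∀ x y, m x y = x → m (n x) (n y) = n x) (x y : A) : n (m x y) = m (n x) (n y) := by
  refine h.antisymm (h.le_meet (ha _ _ (h.meet_le_left _ _)) (ha _ _ (h.meet_le_right _ _))) ?_
  have hx := ha _ _ (h.meet_le_left (n x) (n y))
  have hy := ha _ _ (h.meet_le_right (n x) (n y))
  rw [hn] at hx hy
  simpa only [hn] using ha _ _ (h.le_meet hx hy)

end IsLatticePair

/-! ### Distributive bilattices -/

namespace DBiLat

variable {A : Type u} [BilatAlg A]

theorem neg_and (hA : DBiLat A) (x y : A) : ∼(x ⋏ y) = ∼x ⋎ ∼y :=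
  hA.bilattice.truth.neg_meet hA.bilattice.neg_neg hA.bilattice.neg_truth x y

theorem neg_or (hA : DBiLat A) (x y : A) : ∼(x ⋎ y) = ∼x ⋏ ∼y := by
  refine hA.bilattice.truth.dual.neg_meet hA.bilattice.neg_neg (fun x y h => ?_) x y
  have ht := hA.bilattice.truth
  rw [ht.join_comm, ht.join_eq_iff] at h ⊢
  exact hA.bilattice.neg_truth _ _ h

theorem neg_tensor (hA : DBiLat A) (x y : A) : ∼(x ⊠ y) = ∼x ⊠ ∼y :=
  hA.bilattice.knowledge.map_meet_of_monotone hA.bilattice.neg_neg hA.bilattice.neg_knowledge x y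

theorem neg_oplus (hA : DBiLat A) (x y : A) : ∼(x ⊞ y) = ∼x ⊞ ∼y := by
  refine hA.bilattice.knowledge.dual.map_meet_of_monotone hA.bilattice.neg_neg
    (fun x y h => ?_) x y
  have hk := hA.bilattice.knowledge
  rw [hk.join_comm, hk.join_eq_iff] at h ⊢
  exact hA.bilattice.neg_knowledge _ _ h

/-- The preorder of a distributive bilattice that is the order of the first coordinate in its
representation as a product bilattice. -/
def Below (a b : A) : Prop := a ⋏ (a ⊠ b) = a

/-- Distributivity turns `a ∧ (a ⊗ b)` into `a ⊗ (a ∧ b)`. So the relation is symmetric in the two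
lattices, and facts proved through `≤ₜ` have mirror images through `≤ₖ`. -/
theorem below_iff (hA : DBiLat A) {a b : A} : Below a b ↔ a ⊠ (a ⋏ b) = a := by
  have h : a ⋏ (a ⊠ b) = (a ⋏ a) ⊠ (a ⋏ b) := hA.distrib .and .tensor (by simp) a a b
  rw [Below, h, hA.bilattice.truth.meet_self]

theorem below_of_truth (hA : DBiLat A) {a b : A} (h : a ⋏ b = a) : Below a b := by
  rw [hA.below_iff, h, hA.bilattice.knowledge.meet_self]

theorem below_of_knowledge (hA : DBiLat A) {a b : A} (h : a ⊠ b = a) : Below a b := by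
  rw [Below, h, hA.bilattice.truth.meet_self]

theorem below_refl (hA : DBiLat A) (a : A) : Below a a :=
  hA.below_of_truth (hA.bilattice.truth.meet_self a)

theorem tensor_truth_mono (hA : DBiLat A) {a a' b b' : A} (ha : a ⋏ a' = a) (hb : b ⋏ b' = b) :
    (a ⊠ b) ⋏ (a' ⊠ b') = a ⊠ b :=
  hA.bilattice.truth.monotone hA.bilattice.knowledge.meet_comm
    (hA.distrib .tensor .and (by simp)) ha hb

theorem and_knowledge_mono (hA : DBiLat A) {a a' b b' : A} (ha : a ⊠ a' = a) (hb : b ⊠ b' = b) :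
    (a ⋏ b) ⊠ (a' ⋏ b') = a ⋏ b :=
  hA.bilattice.knowledge.monotone hA.bilattice.truth.meet_comm
    (hA.distrib .and .tensor (by simp)) ha hb

/-- Since `⊗` is `≤ₜ`-monotone, `a ≤ₜ a ⊗ b` and `a ≤ₜ a ⊗ c` combine to `a ≤ₜ (a ⊗ b) ⊗ (a ⊗ c) = a
⊗ (b ⊗ c)`. -/
theorem below_tensor (hA : DBiLat A) {a b c : A} (hb : Below a b) (hc : Below a c) :
    Below a (b ⊠ c) := by
  have h := hA.tensor_truth_mono hb hc
  have hk := hA.bilattice.knowledge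
  have e : (a ⊠ b) ⊠ (a ⊠ c) = a ⊠ (b ⊠ c) := by
    rw [hk.meet_assoc, ← hk.meet_assoc b, hk.meet_comm b a, hk.meet_assoc a b, ← hk.meet_assoc,
      hk.meet_self]
  rwa [hk.meet_self, e] at h

theorem below_and (hA : DBiLat A) {a b c : A} (hb : Below a b) (hc : Below a c) :
    Below a (b ⋏ c) := by
  rw [hA.below_iff] at *
  have h := hA.and_knowledge_mono hb hc
  have hk := hA.bilattice.truth
  have e : (a ⋏ b) ⋏ (a ⋏ c) = a ⋏ (b ⋏ c) := by
    rw [hk.meet_assoc, ← hk.meet_assoc b, hk.meet_comm b a, hk.meet_assoc a b, ← hk.meet_assoc,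
      hk.meet_self]
  rwa [hk.meet_self, e] at h

theorem or_below (hA : DBiLat A) {a b c : A} (ha : Below a c) (hb : Below b c) :
    Below (a ⋎ b) c := by
  have ht := hA.bilattice.truth
  have hk := hA.bilattice.knowledge
  have e : (a ⋎ b) ⊠ c = (a ⊠ c) ⋎ (b ⊠ c) := by
    rw [hk.meet_comm, hk.meet_comm a, hk.meet_comm b]
    exact hA.distrib .tensor .or (by simp) c a b
  rw [Below, e]
  exact ht.join_le (ht.trans ha (ht.le_join_left _ _)) (ht.trans hb (ht.le_join_right _ _))

theorem oplus_below (hA : DBiLat A) {a b c : A} (ha : Below a c) (hb : Below b c) :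
    Below (a ⊞ b) c := by
  have ht := hA.bilattice.truth
  have hk := hA.bilattice.knowledge
  rw [hA.below_iff] at *
  have e : (a ⊞ b) ⋏ c = (a ⋏ c) ⊞ (b ⋏ c) := by
    rw [ht.meet_comm, ht.meet_comm a, ht.meet_comm b]
    exact hA.distrib .and .oplus (by simp) c a b
  rw [e]
  exact hk.join_le (hk.trans ha (hk.le_join_left _ _)) (hk.trans hb (hk.le_join_right _ _))

theorem below_trans (hA : DBiLat A) {a b c : A} (hab : Below a b) (hbc : Below b c) :
    Below a c := by
  have ht := hA.bilattice.truth
  have hk := hA.bilattice.knowledge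
  -- `a ≤ₜ a ⊗ b ≤ₜ a ⊗ (b ⊗ c)`. Distributing then yields `a ≤ₖ (a ∧ b) ⊗ (a ∧ c) ≤ₖ a ∧ c`, the
  -- knowledge form of the conclusion.
  have h : a ⋏ (a ⊠ (b ⊠ c)) = a :=
    ht.trans hab (hA.tensor_truth_mono (ht.meet_self a) hbc)
  have e : a ⋏ (a ⊠ (b ⊠ c)) = a ⊠ ((a ⋏ b) ⊠ (a ⋏ c)) := by
    have h1 : a ⋏ (a ⊠ (b ⊠ c)) = (a ⋏ a) ⊠ (a ⋏ (b ⊠ c)) :=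
      hA.distrib .and .tensor (by simp) _ _ _
    have h2 : a ⋏ (b ⊠ c) = (a ⋏ b) ⊠ (a ⋏ c) := hA.distrib .and .tensor (by simp) _ _ _
    rw [h1, h2, ht.meet_self]
  rw [e] at h
  rw [hA.below_iff]
  exact hk.trans h (hk.meet_le_right _ _)

/-- A distributive bilattice is separated by `Below` on its elements and their negations. -/
theorem eq_of_below (hA : DBiLat A) {a b : A} (hab : Below a b) (hnab : Below ∼a ∼b)
    (hba : Below b a) (hnba : Below ∼b ∼a) : a = b := by
  have ht := hA.bilattice.truth
  have hk := hA.bilattice.knowledge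
  -- Negation reverses `≤ₜ` and commutes with `⊗`. The hypotheses on negations thus give upper
  -- bounds for `a ⊗ b`, and `a ≤ₜ a ⊗ b ≤ₜ b ≤ₜ a ⊗ b ≤ₜ a`.
  have key : ∀ {x y : A}, Below ∼x ∼y → (x ⊠ y) ⋏ x = x ⊠ y := by
    intro x y h
    have h' := hA.bilattice.neg_truth _ _ h
    rwa [← hA.neg_tensor, hA.bilattice.neg_neg, hA.bilattice.neg_neg] at h'
  have h1 : b ⋏ (a ⊠ b) = b := by rw [hk.meet_comm]; exact hba
  have h2 : (a ⊠ b) ⋏ b = a ⊠ b := by rw [hk.meet_comm]; exact key hnba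
  exact ht.antisymm (ht.trans hab h2) (ht.trans h1 (key hnab))

end DBiLat

/-! ### First coordinates -/

/-- `p` is the first coordinate of a representation of `A` as a product bilattice, with values in
a distributive lattice `L`. -/
structure IsFirstCoordinate {A : Type u} [BilatAlg A] {L : Type w} [DistribLattice L]
    (p : A → L) : Prop where
  map_and : ∀ a b, p (a ⋏ b) = p a ⊓ p b
  map_or : ∀ a b, p (a ⋎ b) = p a ⊔ p b
  map_tensor : ∀ a b, p (a ⊠ b) = p a ⊓ p b
  map_oplus : ∀ a b, p (a ⊞ b) = p a ⊔ p b
  le_iff : ∀ a b, p a ≤ p b ↔ DBiLat.Below a b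

/-- `L` is the quotient of `A` by mutual `Below`, with meet and join induced by `∧` and `∨`. For
this preorder `⊗` and `⊕` also give greatest lower and least upper bounds, so they induce the same
operations. -/
theorem DBiLat.exists_isFirstCoordinate {A : Type u} [BilatAlg A] (hA : DBiLat A) :
    ∃ (L : Type u) (_ : DistribLattice L) (p : A → L), IsFirstCoordinate p := by
  have ht := hA.bilattice.truth
  have hk := hA.bilattice.knowledge
  let : Preorder A :=
    { le := DBiLat.Below
      le_refl := hA.below_refl
      le_trans := fun _ _ _ => hA.below_trans }
  have inf_left : ∀ a b : A, a ⋏ b ≤ a := fun a b => hA.below_of_truth (ht.meet_le_left a b)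
  have inf_right : ∀ a b : A, a ⋏ b ≤ b := fun a b => hA.below_of_truth (ht.meet_le_right a b)
  have sup_left : ∀ a b : A, a ≤ a ⋎ b := fun a b => hA.below_of_truth (ht.le_join_left a b)
  have sup_right : ∀ a b : A, b ≤ a ⋎ b := fun a b => hA.below_of_truth (ht.le_join_right a b)
  let L := Antisymmetrization A (· ≤ ·)
  let p : A → L := toAntisymmetrization (· ≤ ·)
  let i : L → L → L := Quotient.map₂ (· ⋏ ·) fun a a' ha b b' hb =>
    ⟨hA.below_and ((inf_left a b).trans ha.1) ((inf_right a b).trans hb.1),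
      hA.below_and ((inf_left a' b').trans ha.2) ((inf_right a' b').trans hb.2)⟩
  let s : L → L → L := Quotient.map₂ (· ⋎ ·) fun a a' ha b b' hb =>
    ⟨hA.or_below (ha.1.trans (sup_left a' b')) (hb.1.trans (sup_right a' b')),
      hA.or_below (ha.2.trans (sup_left a b)) (hb.2.trans (sup_right a b))⟩
  let : Lattice L :=
    { inf := i
      sup := s
      inf_le_left := by rintro ⟨a⟩ ⟨b⟩; exact inf_left a b
      inf_le_right := by rintro ⟨a⟩ ⟨b⟩; exact inf_right a b
      le_inf := by rintro ⟨a⟩ ⟨b⟩ ⟨c⟩ hb hc; exact hA.below_and hb hc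
      le_sup_left := by rintro ⟨a⟩ ⟨b⟩; exact sup_left a b
      le_sup_right := by rintro ⟨a⟩ ⟨b⟩; exact sup_right a b
      sup_le := by rintro ⟨a⟩ ⟨b⟩ ⟨c⟩ ha hb; exact hA.or_below ha hb }
  let : DistribLattice L := DistribLattice.ofInfSupLe <| by
    rintro ⟨a⟩ ⟨b⟩ ⟨c⟩
    have h : a ⋏ (b ⋎ c) = (a ⋏ b) ⋎ (a ⋏ c) := hA.distrib .and .or (by simp) a b c
    change a ⋏ (b ⋎ c) ≤ (a ⋏ b) ⋎ (a ⋏ c)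
    rw [h]
  refine ⟨L, inferInstance, p, fun a b => rfl, fun a b => rfl, fun a b => ?_, fun a b => ?_,
    fun a b => Iff.rfl⟩
  · refine le_antisymm (le_inf ?_ ?_) ?_
    · exact hA.below_of_knowledge (hk.meet_le_left a b)
    · exact hA.below_of_knowledge (hk.meet_le_right a b)
    · exact hA.below_tensor (inf_left a b) (inf_right a b)
  · refine le_antisymm ?_ (sup_le ?_ ?_)
    · exact hA.oplus_below (sup_left a b) (sup_right a b)
    · exact hA.below_of_knowledge (hk.le_join_left a b)
    · exact hA.below_of_knowledge (hk.le_join_right a b)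

/-- The lattice of first coordinates may be taken to be bounded. -/
theorem DBiLat.exists_isFirstCoordinate_bounded {A : Type u} [BilatAlg A] (hA : DBiLat A) :
    ∃ (L : Type u) (_ : DistribLattice L) (_ : BoundedOrder L) (p : A → L),
      IsFirstCoordinate p := by
  obtain ⟨L, _, p, hp⟩ := hA.exists_isFirstCoordinate
  -- The adjoined bounds serve as values of empty contexts; meets, joins and order of the old
  -- elements do not change.
  refine ⟨WithTop (WithBot L), inferInstance, inferInstance,
    fun a => ((p a : WithBot L) : WithTop (WithBot L)), ?_, ?_, ?_, ?_, ?_⟩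
  · intro a b; rw [hp.map_and]; rfl
  · intro a b; rw [hp.map_or]; rfl
  · intro a b; rw [hp.map_tensor]; rfl
  · intro a b; rw [hp.map_oplus]; rfl
  · intro a b; rw [WithTop.coe_le_coe, WithBot.coe_le_coe, hp.le_iff]

/-! ### Translations and valuations -/

theorem Fm.eval_subst {V : Type v} {W : Type w} {A : Type u} [BilatAlg A] (σ : V → Fm W)
    (h : W → A) (φ : Fm V) : (φ.subst σ).eval h = φ.eval fun x => (σ x).eval h := by
  induction φ with
  | var x => rfl
  | neg φ ih => exact congrArg BilatAlg.neg ih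
  | and φ ψ ih₁ ih₂ => exact congrArg₂ BilatAlg.and ih₁ ih₂
  | or φ ψ ih₁ ih₂ => exact congrArg₂ BilatAlg.or ih₁ ih₂
  | tensor φ ψ ih₁ ih₂ => exact congrArg₂ BilatAlg.tensor ih₁ ih₂
  | oplus φ ψ ih₁ ih₂ => exact congrArg₂ BilatAlg.oplus ih₁ ih₂

namespace IsFirstCoordinate

variable {A : Type u} [BilatAlg A] {L : Type w} [DistribLattice L] [BoundedOrder L] {p : A → L}

theorem eval_bigAnd {V : Type v} (hp : IsFirstCoordinate p) (h : V → A) :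
    ∀ (n : ℕ) (f : Fin (n + 1) → Fm V),
      p ((bigAnd n f).eval h) = Finset.univ.inf fun i => p ((f i).eval h)
  | 0, f => by simp [bigAnd]
  | n + 1, f => by
    rw [bigAnd, Fm.eval, hp.map_and, hp.eval_bigAnd h n, Fin.univ_castSuccEmb (n + 1),
      Finset.inf_cons, Finset.inf_map, inf_comm]
    rfl

theorem eval_bigOr {V : Type v} (hp : IsFirstCoordinate p) (h : V → A) :
    ∀ (n : ℕ) (f : Fin (n + 1) → Fm V),
      p ((bigOr n f).eval h) = Finset.univ.sup fun i => p ((f i).eval h)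
  | 0, f => by simp [bigOr]
  | n + 1, f => by
    rw [bigOr, Fm.eval, hp.map_or, hp.eval_bigOr h n, Fin.univ_castSuccEmb (n + 1),
      Finset.sup_cons, Finset.sup_map, sup_comm]
    rfl

/-- Truth of `τ(s)` in terms of first coordinates. -/
theorem holds_tau_iff (hp : IsFirstCoordinate p) (h : ℕ → A) (s : Sequent ℕ) :
    (∀ e ∈ tauLB.apply s, e.Holds h) ↔
      (s.toSets.1.inf fun φ => p (φ.eval h)) ≤ s.toSets.2.sup fun φ => p (φ.eval h) := by
  have hl := hp.eval_bigAnd (fun x => (Sum.elim s.ante s.succ x).eval h) s.m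
    fun i => Fm.var (Sum.inl i)
  have hr := hp.eval_bigOr (fun x => (Sum.elim s.ante s.succ x).eval h) s.n
    fun i => Fm.var (Sum.inr i)
  -- Infima and suprema over an image ignore order and repetition, so the choice of listing is
  -- immaterial.
  rw [Sequent.toSets, Finset.inf_image, Finset.sup_image]
  change _ ↔ (Finset.univ.inf fun i => p ((s.ante i).eval h)) ≤
    Finset.univ.sup fun i => p ((s.succ i).eval h)
  simp only [Fm.eval, Sum.elim_inl, Sum.elim_inr] at hl hr
  rw [← hl, ← hr, hp.le_iff]
  simp only [SeqTranslation.apply, tauLB, Set.image_singleton, Set.mem_singleton_iff,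
    forall_eq, Equation.Holds, Equation.subst, Fm.eval_subst]
  rfl

end IsFirstCoordinate

/-! ### Soundness -/

theorem le_of_cut {L : Type w} [DistribLattice L] {a a' b b' c : L} (h : a ≤ c ⊔ b)
    (h' : c ⊓ a' ≤ b') : a ⊓ a' ≤ b ⊔ b' := by
  calc a ⊓ a' ≤ (c ⊔ b) ⊓ a' := inf_le_inf_right _ h
    _ = c ⊓ a' ⊔ b ⊓ a' := inf_sup_right _ _ _
    _ ≤ b' ⊔ b := sup_le_sup h' inf_le_left
    _ = b ⊔ b' := sup_comm _ _

theorem GLBDerives.sound {A : Type u} [BilatAlg A] (hA : DBiLat A) {L : Type w}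
    [DistribLattice L] [BoundedOrder L] {p : A → L} (hp : IsFirstCoordinate p) (h : ℕ → A)
    {H : Set (Finset (Fm ℕ) × Finset (Fm ℕ))}
    (hH : ∀ x ∈ H, (x.1.inf fun φ => p (φ.eval h)) ≤ x.2.sup fun φ => p (φ.eval h))
    {Γ Δ : Finset (Fm ℕ)} (d : GLBDerives H Γ Δ) :
    (Γ.inf fun φ => p (φ.eval h)) ≤ Δ.sup fun φ => p (φ.eval h) := by
  induction d with
  | hyp hx => exact hH _ hx
  | ax =>
    rw [Finset.inf_insert, Finset.sup_insert]
    exact inf_le_left.trans le_sup_left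
  | cut _ _ ih₁ ih₂ =>
    rw [Finset.sup_insert] at ih₁
    rw [Finset.inf_insert] at ih₂
    rw [Finset.inf_union, Finset.sup_union]
    exact le_of_cut ih₁ ih₂
  -- Once negations are pushed inward, a one-premise rule becomes its premise, and a two-premise
  -- rule is an instance of distributivity.
  | _ =>
    simp only [Finset.inf_insert, Finset.sup_insert, Fm.eval, hA.neg_and, hA.neg_or,
      hA.neg_tensor, hA.neg_oplus, hA.bilattice.neg_neg, hp.map_and, hp.map_or, hp.map_tensor,
      hp.map_oplus, inf_assoc, sup_assoc] at *
    first
      | assumption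
      | (rw [inf_sup_right]; exact sup_le (by assumption) (by assumption))
      | (rw [sup_inf_right]; exact le_inf (by assumption) (by assumption))

/-! ### Completeness -/

/-- The four-element distributive bilattice: pairs of truth values, recording whether a formula
and its negation are accepted. -/
structure Four : Type u where
  pos : Prop
  neg : Prop

namespace Four

instance : BilatAlg Four.{u} where
  and a b := ⟨a.pos ∧ b.pos, a.neg ∨ b.neg⟩
  or a b := ⟨a.pos ∨ b.pos, a.neg ∧ b.neg⟩
  tensor a b := ⟨a.pos ∧ b.pos, a.neg ∧ b.neg⟩
  oplus a b := ⟨a.pos ∨ b.pos, a.neg ∨ b.neg⟩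
  neg a := ⟨a.neg, a.pos⟩

theorem ext_iff' {a b : Four.{u}} : a = b ↔ (a.pos ↔ b.pos) ∧ (a.neg ↔ b.neg) := by
  obtain ⟨_, _⟩ := a
  obtain ⟨_, _⟩ := b
  simp only [Four.mk.injEq, eq_iff_iff]

theorem dBiLat : DBiLat Four.{u} where
  bilattice :=
    { truth := by
        constructor <;> intros <;> simp only [ext_iff', BilatAlg.and, BilatAlg.or] <;> tauto
      knowledge := by
        constructor <;> intros <;> simp only [ext_iff', BilatAlg.tensor, BilatAlg.oplus] <;> tauto
      neg_truth := by
        intro x y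
        simp only [ext_iff', BilatAlg.and, BilatAlg.neg]
        tauto
      neg_knowledge := by
        intro x y
        simp only [ext_iff', BilatAlg.tensor, BilatAlg.neg]
        tauto
      neg_neg := fun _ => rfl }
  distrib := by
    intro o p hop x y z
    cases o <;> cases p <;>
      first
        | exact absurd rfl hop
        | (simp only [ext_iff', LatOp.app, BilatAlg.and, BilatAlg.or, BilatAlg.tensor,
            BilatAlg.oplus]
           tauto)

theorem isFirstCoordinate_pos : IsFirstCoordinate Four.pos.{u} where
  map_and _ _ := rfl
  map_or _ _ := rfl
  map_tensor _ _ := rfl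
  map_oplus _ _ := rfl
  le_iff a b := by
    simp only [DBiLat.Below, ext_iff', BilatAlg.and, BilatAlg.tensor, le_Prop_eq]
    tauto

end Four

namespace GLBDerives

variable {H : Set (Finset (Fm ℕ) × Finset (Fm ℕ))}

theorem nonempty_right (hH : ∀ x ∈ H, x.2.Nonempty) {Γ Δ : Finset (Fm ℕ)}
    (d : GLBDerives H Γ Δ) : Δ.Nonempty := by
  induction d with
  | hyp hx => exact hH _ hx
  | cut _ _ _ ih => exact ih.mono Finset.subset_union_right
  | _ => first | exact Finset.insert_nonempty _ _ | assumption

/-- Weakening is not a rule, but cutting on some `δ ∈ Δ` against the axiom `Γ', δ ▷ δ, Δ'` adds the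
contexts and restores `δ`. This is why the succedent must be non-empty. -/
theorem weaken (hH : ∀ x ∈ H, x.2.Nonempty) {Γ Γ' Δ Δ' : Finset (Fm ℕ)}
    (d : GLBDerives H Γ Δ) (hΓ : Γ ⊆ Γ') (hΔ : Δ ⊆ Δ') : GLBDerives H Γ' Δ' := by
  obtain ⟨δ, hδ⟩ := d.nonempty_right hH
  have h : GLBDerives H (Γ ∪ Γ') (Δ ∪ insert δ Δ') :=
    cut (φ := δ) (by rwa [Finset.insert_eq_of_mem hδ]) ax
  rwa [Finset.insert_eq_of_mem (hΔ hδ), Finset.union_eq_right.2 hΓ,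
    Finset.union_eq_right.2 hΔ] at h

/-- No sequent with antecedent in `T` and succedent in `F` is derivable. -/
def Consistent (H : Set (Finset (Fm ℕ) × Finset (Fm ℕ))) (T F : Set (Fm ℕ)) : Prop :=
  ∀ Γ Δ : Finset (Fm ℕ), (Γ : Set (Fm ℕ)) ⊆ T → (Δ : Set (Fm ℕ)) ⊆ F → ¬ GLBDerives H Γ Δ

/-- A Lindenbaum argument: for fixed `F`, consistency has finite character because antecedents are
finite, so `T` extends to a maximal `M`. Cut then shows that nothing leads from `M` to its
complement. -/
theorem Consistent.exists_compl {T F : Set (Fm ℕ)} (h : Consistent H T F) :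
    ∃ T', T ⊆ T' ∧ F ⊆ T'ᶜ ∧ Consistent H T' T'ᶜ := by
  have hfin : Order.IsOfFiniteCharacter {T | Consistent H T F} := by
    intro T
    constructor
    · intro hT Y hY _ Γ Δ hΓ hΔ
      exact hT Γ Δ (hΓ.trans hY) hΔ
    · intro hT Γ Δ hΓ hΔ
      exact hT Γ hΓ Γ.finite_toSet Γ Δ subset_rfl hΔ
  obtain ⟨M, hTM, hM⟩ := hfin.exists_maximal h
  -- Formulas outside `M` are cut from the succedent one by one: by maximality each `δ ∉ M` occurs
  -- in the antecedent of a derivable sequent from `insert δ M` to `F`. The contexts grow only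
  -- within `M` and `F`.
  have hcut : ∀ Δ' Γ Δ : Finset (Fm ℕ), (Γ : Set (Fm ℕ)) ⊆ M → (Δ : Set (Fm ℕ)) ⊆ F →
      (Δ' : Set (Fm ℕ)) ⊆ Mᶜ → ¬ GLBDerives H Γ (Δ' ∪ Δ) := by
    intro Δ'
    induction Δ' using Finset.induction_on with
    | empty =>
      intro Γ Δ hΓ hΔ _ d
      exact hM.prop Γ Δ hΓ hΔ (by simpa using d)
    | insert δ Δ' _ ih =>
      intro Γ Δ hΓ hΔ hΔ' d
      rw [Finset.coe_insert, Set.insert_subset_iff] at hΔ'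
      obtain ⟨hδ, hΔ'⟩ := hΔ'
      have hnot : ¬ Consistent H (insert δ M) F := fun hc =>
        hδ (hM.le_of_ge hc (Set.subset_insert _ _) (Set.mem_insert _ _))
      simp only [Consistent, not_forall, not_not] at hnot
      obtain ⟨Γ₁, Δ₁, hΓ₁, hΔ₁, d₁⟩ := hnot
      have hmem : δ ∈ Γ₁ := by
        by_contra hn
        refine hM.prop Γ₁ Δ₁ (fun x hx => ?_) hΔ₁ d₁
        rcases hΓ₁ hx with rfl | hx'
        · exact absurd hx hn
        · exact hx'
      rw [← Finset.insert_erase hmem] at d₁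
      rw [Finset.insert_union] at d
      have d₂ := cut d d₁
      rw [Finset.union_assoc] at d₂
      refine ih _ _ ?_ ?_ hΔ' d₂
      · rw [Finset.coe_union, Set.union_subset_iff]
        refine ⟨hΓ, fun x hx => ?_⟩
        rw [Finset.mem_coe, Finset.mem_erase] at hx
        exact (hΓ₁ hx.2).resolve_left hx.1
      · rw [Finset.coe_union, Set.union_subset_iff]
        exact ⟨hΔ, hΔ₁⟩
  refine ⟨M, hTM, fun δ hδ hδM => ?_, fun Γ Δ hΓ hΔ d => ?_⟩
  · exact hM.prop {δ} {δ} (by simpa using hδM) (by simpa using hδ) (ax (Γ := ∅) (Δ := ∅))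
  · exact hcut Δ Γ ∅ hΓ (by simp) hΔ (by simpa using d)

section Theory

variable {T : Set (Fm ℕ)} {φ ψ χ : Fm ℕ}

/-- This lemma and the next two read derivable sequents as closure and primeness conditions on `T`.
-/
theorem Consistent.mem_of_derives (hT : Consistent H T Tᶜ)
    (d : GLBDerives H {φ} {ψ}) (h : φ ∈ T) : ψ ∈ T := by
  by_contra hn
  exact hT _ _ (by simpa using h) (by simpa using hn) d

theorem Consistent.mem_of_derives₂ (hT : Consistent H T Tᶜ)
    (d : GLBDerives H {φ, ψ} {χ}) (h : φ ∈ T) (h' : ψ ∈ T) : χ ∈ T := by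
  by_contra hn
  exact hT _ _ (by simp [Set.insert_subset_iff, h, h']) (by simpa using hn) d

theorem Consistent.mem_or_mem_of_derives (hT : Consistent H T Tᶜ)
    (d : GLBDerives H {χ} {φ, ψ}) (h : χ ∈ T) : φ ∈ T ∨ ψ ∈ T := by
  by_contra hn
  rw [not_or] at hn
  exact hT _ _ (by simpa using h) (by simp [Set.insert_subset_iff, hn]) d

theorem ax_left : GLBDerives H {φ, ψ} {φ} := ax (Γ := {ψ}) (Δ := ∅)

theorem ax_left' : GLBDerives H {φ, ψ} {ψ} := by
  rw [Finset.pair_comm]; exact ax_left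

theorem ax_right : GLBDerives H {φ} {φ, ψ} := ax (Γ := ∅) (Δ := {ψ})

theorem ax_right' : GLBDerives H {ψ} {φ, ψ} := by
  rw [Finset.pair_comm]; exact ax_right

theorem ax_single : GLBDerives H {φ} {φ} := ax (Γ := ∅) (Δ := ∅)

/-- Every consistent partition of the formulas is given by a valuation in `Four`. -/
theorem Consistent.eval_eq (hT : Consistent H T Tᶜ) (φ : Fm ℕ) :
    φ.eval (fun n => (⟨.var n ∈ T, (Fm.var n).neg ∈ T⟩ : Four.{u})) = ⟨φ ∈ T, φ.neg ∈ T⟩ := by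
  -- The induction hypothesis describes `φ` and `¬φ` together, so for each binary connective the
  -- plain rules settle the first component and the negated rules the second.
  induction φ with
  | var n => rfl
  | neg φ ih =>
    rw [Fm.eval, ih, Four.ext_iff']
    exact ⟨Iff.rfl, hT.mem_of_derives (neg_neg_right (Δ := ∅) ax_single),
      hT.mem_of_derives (neg_neg_left (Γ := ∅) ax_single)⟩
  | and φ ψ ih₁ ih₂ =>
    rw [Fm.eval, ih₁, ih₂, Four.ext_iff']
    exact ⟨⟨fun h => hT.mem_of_derives₂ (and_right (Δ := ∅) ax_left ax_left') h.1 h.2,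
      fun h => ⟨hT.mem_of_derives (and_left (Γ := ∅) ax_left) h,
        hT.mem_of_derives (and_left (Γ := ∅) ax_left') h⟩⟩,
      fun h => h.elim (hT.mem_of_derives (neg_and_right (Δ := ∅) ax_right))
        (hT.mem_of_derives (neg_and_right (Δ := ∅) ax_right')),
      hT.mem_or_mem_of_derives (neg_and_left (Γ := ∅) ax_right ax_right')⟩
  | or φ ψ ih₁ ih₂ =>
    rw [Fm.eval, ih₁, ih₂, Four.ext_iff']
    exact ⟨⟨fun h => h.elim (hT.mem_of_derives (or_right (Δ := ∅) ax_right))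
        (hT.mem_of_derives (or_right (Δ := ∅) ax_right')),
      hT.mem_or_mem_of_derives (or_left (Γ := ∅) ax_right ax_right')⟩,
      fun h => hT.mem_of_derives₂ (neg_or_right (Δ := ∅) ax_left ax_left') h.1 h.2,
      fun h => ⟨hT.mem_of_derives (neg_or_left (Γ := ∅) ax_left) h,
        hT.mem_of_derives (neg_or_left (Γ := ∅) ax_left') h⟩⟩
  | tensor φ ψ ih₁ ih₂ =>
    rw [Fm.eval, ih₁, ih₂, Four.ext_iff']
    exact ⟨⟨fun h => hT.mem_of_derives₂ (tensor_right (Δ := ∅) ax_left ax_left') h.1 h.2,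
      fun h => ⟨hT.mem_of_derives (tensor_left (Γ := ∅) ax_left) h,
        hT.mem_of_derives (tensor_left (Γ := ∅) ax_left') h⟩⟩,
      fun h => hT.mem_of_derives₂ (neg_tensor_right (Δ := ∅) ax_left ax_left') h.1 h.2,
      fun h => ⟨hT.mem_of_derives (neg_tensor_left (Γ := ∅) ax_left) h,
        hT.mem_of_derives (neg_tensor_left (Γ := ∅) ax_left') h⟩⟩
  | oplus φ ψ ih₁ ih₂ =>
    rw [Fm.eval, ih₁, ih₂, Four.ext_iff']
    exact ⟨⟨fun h => h.elim (hT.mem_of_derives (oplus_right (Δ := ∅) ax_right))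
        (hT.mem_of_derives (oplus_right (Δ := ∅) ax_right')),
      hT.mem_or_mem_of_derives (oplus_left (Γ := ∅) ax_right ax_right')⟩,
      fun h => h.elim (hT.mem_of_derives (neg_oplus_right (Δ := ∅) ax_right))
        (hT.mem_of_derives (neg_oplus_right (Δ := ∅) ax_right')),
      hT.mem_or_mem_of_derives (neg_oplus_left (Γ := ∅) ax_right ax_right')⟩

end Theory

/-! ### Finitarity -/

theorem mono {H' : Set (Finset (Fm ℕ) × Finset (Fm ℕ))} (hH : H ⊆ H') {Γ Δ : Finset (Fm ℕ)}
    (d : GLBDerives H Γ Δ) : GLBDerives H' Γ Δ := by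
  induction d with
  | hyp hx => exact hyp (hH hx)
  | ax => exact ax
  | cut _ _ ih₁ ih₂ => exact cut ih₁ ih₂
  | and_left _ ih => exact and_left ih
  | and_right _ _ ih₁ ih₂ => exact and_right ih₁ ih₂
  | neg_and_left _ _ ih₁ ih₂ => exact neg_and_left ih₁ ih₂
  | neg_and_right _ ih => exact neg_and_right ih
  | or_left _ _ ih₁ ih₂ => exact or_left ih₁ ih₂
  | or_right _ ih => exact or_right ih
  | neg_or_left _ ih => exact neg_or_left ih
  | neg_or_right _ _ ih₁ ih₂ => exact neg_or_right ih₁ ih₂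
  | tensor_left _ ih => exact tensor_left ih
  | tensor_right _ _ ih₁ ih₂ => exact tensor_right ih₁ ih₂
  | neg_tensor_left _ ih => exact neg_tensor_left ih
  | neg_tensor_right _ _ ih₁ ih₂ => exact neg_tensor_right ih₁ ih₂
  | oplus_left _ _ ih₁ ih₂ => exact oplus_left ih₁ ih₂
  | oplus_right _ ih => exact oplus_right ih
  | neg_oplus_left _ _ ih₁ ih₂ => exact neg_oplus_left ih₁ ih₂
  | neg_oplus_right _ ih => exact neg_oplus_right ih
  | neg_neg_left _ ih => exact neg_neg_left ih
  | neg_neg_right _ ih => exact neg_neg_right ih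

theorem exists_finite {Γ Δ : Finset (Fm ℕ)} (d : GLBDerives H Γ Δ) :
    ∃ F ⊆ H, F.Finite ∧ GLBDerives F Γ Δ := by
  -- `one` and `two` carry a rule, valid over every set of hypotheses, to finite subsets of `H`; two
  -- premises need a union.
  have one : ∀ {Γ Δ Γ' Δ' : Finset (Fm ℕ)},
      (∀ {F}, GLBDerives F Γ Δ → GLBDerives F Γ' Δ') →
      (∃ F ⊆ H, F.Finite ∧ GLBDerives F Γ Δ) → ∃ F ⊆ H, F.Finite ∧ GLBDerives F Γ' Δ' :=
    fun r ⟨F, hF, hfin, d⟩ => ⟨F, hF, hfin, r d⟩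
  have two : ∀ {Γ₁ Δ₁ Γ₂ Δ₂ Γ' Δ' : Finset (Fm ℕ)},
      (∀ {F}, GLBDerives F Γ₁ Δ₁ → GLBDerives F Γ₂ Δ₂ → GLBDerives F Γ' Δ') →
      (∃ F ⊆ H, F.Finite ∧ GLBDerives F Γ₁ Δ₁) → (∃ F ⊆ H, F.Finite ∧ GLBDerives F Γ₂ Δ₂) →
      ∃ F ⊆ H, F.Finite ∧ GLBDerives F Γ' Δ' :=
    fun r ⟨F₁, h₁, f₁, d₁⟩ ⟨F₂, h₂, f₂, d₂⟩ => ⟨F₁ ∪ F₂, Set.union_subset h₁ h₂, f₁.union f₂,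
      r (d₁.mono Set.subset_union_left) (d₂.mono Set.subset_union_right)⟩
  induction d with
  | hyp hx => exact ⟨_, Set.singleton_subset_iff.2 hx, Set.finite_singleton _, hyp rfl⟩
  | ax => exact ⟨∅, Set.empty_subset _, Set.finite_empty, ax⟩
  | cut _ _ ih₁ ih₂ => exact two cut ih₁ ih₂
  | and_left _ ih => exact one and_left ih
  | and_right _ _ ih₁ ih₂ => exact two and_right ih₁ ih₂
  | neg_and_left _ _ ih₁ ih₂ => exact two neg_and_left ih₁ ih₂
  | neg_and_right _ ih => exact one neg_and_right ih
  | or_left _ _ ih₁ ih₂ => exact two or_left ih₁ ih₂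
  | or_right _ ih => exact one or_right ih
  | neg_or_left _ ih => exact one neg_or_left ih
  | neg_or_right _ _ ih₁ ih₂ => exact two neg_or_right ih₁ ih₂
  | tensor_left _ ih => exact one tensor_left ih
  | tensor_right _ _ ih₁ ih₂ => exact two tensor_right ih₁ ih₂
  | neg_tensor_left _ ih => exact one neg_tensor_left ih
  | neg_tensor_right _ _ ih₁ ih₂ => exact two neg_tensor_right ih₁ ih₂
  | oplus_left _ _ ih₁ ih₂ => exact two oplus_left ih₁ ih₂
  | oplus_right _ ih => exact one oplus_right ih
  | neg_oplus_left _ _ ih₁ ih₂ => exact two neg_oplus_left ih₁ ih₂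
  | neg_oplus_right _ ih => exact one neg_oplus_right ih
  | neg_neg_left _ ih => exact one neg_neg_left ih
  | neg_neg_right _ ih => exact one neg_neg_right ih

end GLBDerives

/-! ### The equivalence between `G_LB` and equational consequence -/

theorem eqConseq_tau_of_GLB {X : Set (Sequent ℕ)} {s : Sequent ℕ} (d : GLB X s) :
    ∀ e ∈ tauLB.apply s, EqConseq DBiLat.{u} (tauLB.applySet X) e := by
  intro e he A _ hA h hX
  obtain ⟨L, _, _, p, hp⟩ := hA.exists_isFirstCoordinate_bounded
  refine (hp.holds_tau_iff h s).2 (d.sound hA hp h ?_) e he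
  rintro _ ⟨x, hx, rfl⟩
  exact (hp.holds_tau_iff h x).1 fun e he => hX e (Set.mem_biUnion hx he)

theorem GLB_of_eqConseq_tau {X : Set (Sequent ℕ)} {s : Sequent ℕ}
    (hs : ∀ e ∈ tauLB.apply s, EqConseq DBiLat.{u} (tauLB.applySet X) e) : GLB X s := by
  by_contra hd
  have hne : ∀ x ∈ Sequent.toSets '' X, x.2.Nonempty := by
    rintro _ ⟨x, _, rfl⟩
    exact Finset.univ_nonempty.image _
  have hcons : GLBDerives.Consistent (Sequent.toSets '' X) s.toSets.1 s.toSets.2 :=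
    fun Γ Δ hΓ hΔ d => hd (d.weaken hne (Finset.coe_subset.1 hΓ) (Finset.coe_subset.1 hΔ))
  obtain ⟨T, hT₁, hT₂, hT⟩ := hcons.exists_compl
  let h : ℕ → Four.{u} := fun n => ⟨.var n ∈ T, (Fm.var n).neg ∈ T⟩
  have hpos : ∀ φ : Fm ℕ, (φ.eval h).pos = (φ ∈ T) := fun φ => by rw [hT.eval_eq]
  -- The valuation refutes `τ(x)` exactly when `x` leads from `T` into its complement. Consistency
  -- excludes this for the hypotheses, while `s` does so by construction.
  have key : ∀ x : Sequent ℕ, (∀ e ∈ tauLB.apply x, e.Holds h) ↔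
      ((x.toSets.1 : Set (Fm ℕ)) ⊆ T → ¬ (x.toSets.2 : Set (Fm ℕ)) ⊆ Tᶜ) := by
    intro x
    rw [Four.isFirstCoordinate_pos.holds_tau_iff h x]
    simp only [hpos]
    have hinf : ∀ Γ : Finset (Fm ℕ), (Γ.inf fun φ => φ ∈ T) ↔ (Γ : Set (Fm ℕ)) ⊆ T := by
      intro Γ
      induction Γ using Finset.induction_on with
      | empty => simp
      | insert φ Γ _ ih =>
        rw [Finset.inf_insert, Finset.coe_insert, Set.insert_subset_iff, ← ih]
        rfl
    have hsup : ∀ Δ : Finset (Fm ℕ), (Δ.sup fun φ => φ ∈ T) ↔ ¬ (Δ : Set (Fm ℕ)) ⊆ Tᶜ := by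
      intro Δ
      induction Δ using Finset.induction_on with
      | empty => simp
      | insert φ Δ _ ih =>
        rw [Finset.sup_insert, Finset.coe_insert, Set.insert_subset_iff, not_and_or, ← ih,
          Set.mem_compl_iff, not_not]
        rfl
    rw [← hinf, ← hsup]
    rfl
  refine (key s).1 (fun e he => hs e he Four Four.dBiLat h fun d hd => ?_) hT₁ hT₂
  obtain ⟨x, hx, hdx⟩ := Set.mem_iUnion₂.1 hd
  exact (key x).2 (fun h₁ h₂ => hT _ _ h₁ h₂ (.hyp ⟨x, hx, rfl⟩)) d hdx

theorem GLB_iff_eqConseq (X : Set (Sequent ℕ)) (s : Sequent ℕ) :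
    GLB X s ↔ ∀ e ∈ tauLB.apply s, EqConseq DBiLat.{u} (tauLB.applySet X) e :=
  ⟨eqConseq_tau_of_GLB, GLB_of_eqConseq_tau⟩

theorem holds_tau_subst_iff {A : Type u} [BilatAlg A] (hA : DBiLat A) (σ : ℕ → Fm ℕ) (h : ℕ → A)
    (s : Sequent ℕ) : (∀ e ∈ tauLB.apply (s.subst σ), e.Holds h) ↔
      ∀ e ∈ tauLB.apply s, e.Holds fun x => (σ x).eval h := by
  obtain ⟨L, _, _, p, hp⟩ := hA.exists_isFirstCoordinate_bounded
  rw [hp.holds_tau_iff, hp.holds_tau_iff]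
  simp only [Sequent.toSets, Finset.inf_image, Finset.sup_image, Sequent.subst,
    Function.comp_def, Fm.eval_subst]
  rfl

/-- Transitivity and structurality are inherited from equational consequence; finitarity comes from
derivations. `GLB` involves no universe of algebras, so the equivalence may be used at level `0`. -/
theorem isGentzenSystem_GLB : IsGentzenSystem GLB where
  refl X s hs := .hyp ⟨s, hs, rfl⟩
  trans X Y s hY hs := by
    rw [GLB_iff_eqConseq.{0}] at *
    replace hY := fun y hy => eqConseq_tau_of_GLB.{0} (hY y hy)
    intro e he A _ hA h hX
    refine hs e he A hA h fun d hd => ?_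
    obtain ⟨y, hy, hdy⟩ := Set.mem_iUnion₂.1 hd
    exact hY y hy d hdy A hA h hX
  finitary X s hs := by
    exact Set.exists_subset_image_finite_and.1 (GLBDerives.exists_finite hs)
  structural σ X s hs := by
    rw [GLB_iff_eqConseq.{0}] at *
    intro e he A _ hA h hX
    refine (holds_tau_subst_iff hA σ h s).2 (fun e he => hs e he A hA _ fun d hd => ?_) e he
    obtain ⟨x, hx, hdx⟩ := Set.mem_iUnion₂.1 hd
    refine (holds_tau_subst_iff hA σ h x).1 (fun d hd => hX d ?_) d hdx
    exact Set.mem_biUnion (Set.mem_image_of_mem _ hx) hd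

theorem holds_tau_single_iff {A : Type u} [BilatAlg A] (hA : DBiLat A) (h : ℕ → A)
    (φ ψ : Fm ℕ) : (∀ e ∈ tauLB.apply (.single φ ψ), e.Holds h) ↔
      DBiLat.Below (φ.eval h) (ψ.eval h) := by
  obtain ⟨L, _, _, p, hp⟩ := hA.exists_isFirstCoordinate_bounded
  have hs : (Sequent.single φ ψ).toSets = ({φ}, {ψ}) := rfl
  rw [hp.holds_tau_iff, ← hp.le_iff, hs, Finset.inf_singleton, Finset.sup_singleton]

/-- The four sequents of `ρ` express exactly the hypotheses of `eq_of_below`; the converse is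
reflexivity. -/
theorem holds_tau_rho_iff {A : Type u} [BilatAlg A] (hA : DBiLat A) (h : ℕ → A)
    (e : Equation ℕ) : (∀ d ∈ tauLB.applySet (rhoLB.apply e), d.Holds h) ↔ e.Holds h := by
  have hρ : rhoLB.apply e = {Sequent.single e.lhs e.rhs, Sequent.single e.lhs.neg e.rhs.neg,
      Sequent.single e.rhs e.lhs, Sequent.single e.rhs.neg e.lhs.neg} := by
    simp only [EqTranslation.apply, rhoLB, Set.image_insert_eq, Set.image_singleton]
    rfl
  have hτ : (∀ d ∈ tauLB.applySet (rhoLB.apply e), d.Holds h) ↔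
      ∀ s ∈ rhoLB.apply e, ∀ d ∈ tauLB.apply s, d.Holds h := by
    simp only [SeqTranslation.applySet, Set.mem_iUnion₂]
    exact ⟨fun H s hs d hd => H d ⟨s, hs, hd⟩, fun H d ⟨s, hs, hd⟩ => H s hs d hd⟩
  rw [hτ, hρ]
  simp only [Set.mem_insert_iff, Set.mem_singleton_iff, forall_eq_or_imp, forall_eq,
    holds_tau_single_iff hA]
  constructor
  · rintro ⟨h₁, h₂, h₃, h₄⟩
    exact hA.eq_of_below h₁ h₂ h₃ h₄
  · intro he
    have he' : e.lhs.eval h = e.rhs.eval h := he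
    simp only [Fm.eval, he']
    exact ⟨hA.below_refl _, hA.below_refl _, hA.below_refl _, hA.below_refl _⟩

theorem isAlgebraizable_GLB : IsAlgebraizable GLB DBiLat.{u} tauLB rhoLB where
  system := isGentzenSystem_GLB
  finite_τ _ _ := Set.finite_singleton _
  finite_ρ := Set.toFinite {_, _, _, _}
  conseq_iff := GLB_iff_eqConseq
  eq_conseq_τρ e d hd _ _ hA h he :=
    (holds_tau_rho_iff hA h e).2 (he e rfl) d hd
  τρ_conseq_eq e _ _ hA h H := (holds_tau_rho_iff hA h e).1 H

/-! ### `DBiLat` is a variety -/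

def LatOp.fm {V : Type v} : LatOp → Fm V → Fm V → Fm V
  | .and => Fm.and
  | .or => Fm.or
  | .tensor => Fm.tensor
  | .oplus => Fm.oplus

theorem LatOp.eval_fm {V : Type v} {A : Type u} [BilatAlg A] (o : LatOp) (h : V → A)
    (φ ψ : Fm V) : (o.fm φ ψ).eval h = o.app (φ.eval h) (ψ.eval h) := by
  cases o <;> rfl

/-- The witness is the set of all equations valid in `DBiLat`; each defining condition must then be
recovered from valid equations. -/
theorem isVariety_dBiLat : IsVariety DBiLat.{u} := by
  refine ⟨{e | ∀ (A : Type u) [BilatAlg A], DBiLat A → ∀ h : ℕ → A, e.Holds h},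
    fun A _ => ⟨fun hA e he h => he A hA h, fun H => ?_⟩⟩
  have law : ∀ (a b : Fm ℕ), (∀ (B : Type u) [BilatAlg B], DBiLat B → ∀ h : ℕ → B,
      a.eval h = b.eval h) → ∀ x y z : A,
      a.eval (fun n => if n = 0 then x else if n = 1 then y else z) =
        b.eval (fun n => if n = 0 then x else if n = 1 then y else z) :=
    fun a b hab x y z => H ⟨a, b⟩ hab _
  have pair : ∀ o p : LatOp, (∀ (B : Type u) [BilatAlg B], DBiLat B →
      IsLatticePair (o.app (A := B)) p.app) → IsLatticePair (o.app (A := A)) p.app := by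
    intro o p hop
    refine ⟨fun x y => ?_, fun x y => ?_, fun x y z => ?_, fun x y z => ?_, fun x y => ?_,
      fun x y => ?_⟩
    · simpa [LatOp.eval_fm, Fm.eval] using law (o.fm (.var 0) (.var 1)) (o.fm (.var 1) (.var 0))
        (fun B _ hB h => by simpa only [LatOp.eval_fm] using (hop B hB).meet_comm _ _) x y y
    · simpa [LatOp.eval_fm, Fm.eval] using law (p.fm (.var 0) (.var 1)) (p.fm (.var 1) (.var 0))
        (fun B _ hB h => by simpa only [LatOp.eval_fm] using (hop B hB).join_comm _ _) x y y
    · simpa [LatOp.eval_fm, Fm.eval] using law (o.fm (o.fm (.var 0) (.var 1)) (.var 2))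
        (o.fm (.var 0) (o.fm (.var 1) (.var 2)))
        (fun B _ hB h => by simpa only [LatOp.eval_fm] using (hop B hB).meet_assoc _ _ _) x y z
    · simpa [LatOp.eval_fm, Fm.eval] using law (p.fm (p.fm (.var 0) (.var 1)) (.var 2))
        (p.fm (.var 0) (p.fm (.var 1) (.var 2)))
        (fun B _ hB h => by simpa only [LatOp.eval_fm] using (hop B hB).join_assoc _ _ _) x y z
    · simpa [LatOp.eval_fm, Fm.eval] using law (o.fm (.var 0) (p.fm (.var 0) (.var 1))) (.var 0)
        (fun B _ hB h => by simpa only [LatOp.eval_fm] using (hop B hB).meet_join _ _) x y y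
    · simpa [LatOp.eval_fm, Fm.eval] using law (p.fm (.var 0) (o.fm (.var 0) (.var 1))) (.var 0)
        (fun B _ hB h => by simpa only [LatOp.eval_fm] using (hop B hB).join_meet _ _) x y y
  have ht : IsLatticePair (A := A) BilatAlg.and BilatAlg.or :=
    pair .and .or fun B _ hB => hB.bilattice.truth
  have hk : IsLatticePair (A := A) BilatAlg.tensor BilatAlg.oplus :=
    pair .tensor .oplus fun B _ hB => hB.bilattice.knowledge
  refine ⟨⟨ht, hk, fun x y hxy => ?_, fun x y hxy => ?_, fun x => ?_⟩, fun o p hop x y z => ?_⟩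
  -- For `x ≤ₜ y` the left side is `∼y`, so this De Morgan law yields antitonicity; the identity for
  -- `⊗` below yields `≤ₖ`-monotonicity likewise.
  · have h : ∼(x ⋎ y) = ∼x ⋏ ∼y := law (.neg (.or (.var 0) (.var 1)))
      (.and (.neg (.var 0)) (.neg (.var 1))) (fun B _ hB h => hB.neg_or _ _) x y y
    rw [ht.join_eq_iff.2 hxy, ht.meet_comm] at h
    exact h.symm
  · have h : ∼(x ⊠ y) = ∼x ⊠ ∼y := law (.neg (.tensor (.var 0) (.var 1)))
      (.tensor (.neg (.var 0)) (.neg (.var 1))) (fun B _ hB h => hB.neg_tensor _ _) x y y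
    rw [← h, hxy]
  · exact law (.neg (.neg (.var 0))) (.var 0) (fun B _ hB h => hB.bilattice.neg_neg _) x x x
  · simpa [LatOp.eval_fm, Fm.eval] using law (o.fm (.var 0) (p.fm (.var 1) (.var 2)))
      (p.fm (o.fm (.var 0) (.var 1)) (o.fm (.var 0) (.var 2)))
      (fun B _ hB h => by simpa only [LatOp.eval_fm] using hB.distrib o p hop _ _ _) x y z

theorem mainTheorem5 :
    IsVariety DBiLat.{u} ∧ IsAlgebraizable GLB DBiLat.{u} tauLB rhoLB :=
  ⟨isVariety_dBiLat, isAlgebraizable_GLB⟩
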